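/- For a (partial or total) Boolean function $F$ on $\{0,1\}^n$ with domain $X\subseteq\{0,1\}^n$, let $\mathrm{udeg}(F)$ be the lowest degree of a real multilinear polynomial $q$ in $n$ variables with $q(x)\in[0,1]$ for all $x\in\{0,1\}^n$ such that, for all $x\in X$, $q(x)>1/2$ if $F(x)=1$ and $q(x)<1/2$ if $F(x)=0$. Let $F^{\wedge}(x,y)=F(x\wedge y)$ for $x,y\in\{0,1\}^n$ with $x\wedge y\in X$, where $\wedge$ is the bitwise AND. Let $k_{F^{\wedge}}$ be the smallest $k\ge 0$ for which there are points $p_x\in\mathbb{R}^k$ and hyperplane coefficients $(h_y,t_y)\in\mathbb{R}^k\times\mathbb{R}$ ($x,y\in\{0,1\}^n$) such that, whenever $x\wedge y\in X$, $\langle p_x,h_y\rangle-t_y>0$ if $F^{\wedge}(x,y)=1$ and $\langle p_x,h_y\rangle-t_y<0$ if $F^{\wedge}(x,y)=0$ (an arrangement of dimension $k$ realizing $F^{\wedge}$). There is an absolute constant $c>0$ such that for every $n\ge 2$ and every such $F$, $$\mathrm{udeg}(F)\ \ge\ c\,\frac{\log k_{F^{\wedge}}}{\log n},$$ where $\log 0$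 is read as $0$ (the case $k_{F^\wedge}=0$ occurs only for functions $F$ that are constant on their domain). Moreover, this relation is tight for the functions $\mathrm{OMB}_n$ (ODD-MAX-BIT): as $n\to\infty$, $$\mathrm{udeg}(\mathrm{OMB}_n)=\Theta\!\left(\frac{\log k_{\mathrm{OMB}_n^{\wedge}}}{\log n}\right),$$ where $\mathrm{OMB}_n(x)=m \bmod 2$ for the largest index $m\in\{1,\dots,n\}$ with $x_m=1$ (and $m=0$ if $x=0^n$). -/

import Mathlib

/-- A (partial or total) Boolean function of `n` variables: `F x = none` means that `x` is outside
the domain of `F`, and `F x = some b` means `F x = b`. -/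
abbrev BoolFn (n : ℕ) : Type := (Fin n → Bool) → Option Bool

/-- A total Boolean function, as a Boolean function whose domain is the whole cube. -/
def BoolFn.ofTotal {n : ℕ} (F : (Fin n → Bool) → Bool) : BoolFn n := fun x => some (F x)

/-- The value of a real polynomial at a point of the Boolean cube (bits read as the reals 0, 1). -/
noncomputable def evalBits {n : ℕ} (q : MvPolynomial (Fin n) ℝ) (x : Fin n → Bool) : ℝ :=
  MvPolynomial.eval (fun i => if x i then (1 : ℝ) else 0) q

/-- `q` is an unbounded error polynomial for `F`: it is multilinear, maps the cube into `[0,1]`,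
is greater than `1/2` where `F = 1`, and less than `1/2` where `F = 0`. -/
structure IsUnboundedErrorPoly {n : ℕ} (F : BoolFn n) (q : MvPolynomial (Fin n) ℝ) : Prop where
  multilinear : ∀ i, q.degreeOf i ≤ 1
  mem_Icc : ∀ x, evalBits q x ∈ Set.Icc (0 : ℝ) 1
  gt_half : ∀ x, F x = some true → 1 / 2 < evalBits q x
  lt_half : ∀ x, F x = some false → evalBits q x < 1 / 2

/-- The lowest degree among all unbounded error polynomials for `F`
(one always exists: interpolate `F` on the cube by a multilinear polynomial). -/
noncomputable def udeg {n : ℕ} (F : BoolFn n) : ℕ :=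
  sInf {d | ∃ q : MvPolynomial (Fin n) ℝ, IsUnboundedErrorPoly F q ∧ q.totalDegree = d}

/-- A `k`-dimensional arrangement of points `p_x ∈ ℝ^k`, `x ∈ A`, and of hyperplanes
`{z ∈ ℝ^k | ⟨z, normal y⟩ = offset y}`, `y ∈ B`, each given by its `k + 1` real coefficients. -/
structure Arrangement (A B : Type*) (k : ℕ) where
  point : A → Fin k → ℝ
  normal : B → Fin k → ℝ
  offset : B → ℝ

/-- The arrangement realizes the two-party (partial) function `f`: the point of `x` lies strictly on
the positive side of the hyperplane of `y` if `f x y = 1`, strictly on the negative side if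
`f x y = 0`. -/
def Arrangement.Realizes {A B : Type*} {k : ℕ} (P : Arrangement A B k)
    (f : A → B → Option Bool) : Prop :=
  ∀ x y, (f x y = some true → 0 < dotProduct (P.point x) (P.normal y) - P.offset y) ∧
    (f x y = some false → dotProduct (P.point x) (P.normal y) - P.offset y < 0)

/-- The smallest dimension of an arrangement that realizes `f`
(for finite `A` one always exists: the standard basis of `ℝ^A` as points). -/
noncomputable def arrDim {A B : Type*} (f : A → B → Option Bool) : ℕ :=
  sInf {k | ∃ P : Arrangement A B k, P.Realizes f}

/-- The distributed function `F^∧(x, y) = F(x ∧ y)`, with the bitwise AND. -/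
def distAnd {n : ℕ} (F : BoolFn n) (x y : Fin n → Bool) : Option Bool :=
  F (fun i => x i && y i)

/-- The largest index `k ∈ {1, …, n}` with `x_k = 1`, and `0` if `x = 0^n`
(the variable `x_k` is `x i` with `i = k - 1` in `Fin n`). -/
def maxBit {n : ℕ} (x : Fin n → Bool) : ℕ :=
  (Finset.univ.filter fun i => x i = true).sup fun i => (i : ℕ) + 1

/-- ODD-MAX-BIT: the parity of the largest index of a one in `x`. -/
def oddMaxBit (n : ℕ) (x : Fin n → Bool) : Bool := decide (maxBit x % 2 = 1)

/-!
An unbounded error polynomial `q` of degree `d` has at most `(n + 1) ^ d` monomials, and a monomial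
evaluated at `x ∧ y` is the product of its values at `x` and at `y`. Hence `q (x ∧ y) - 1/2` is the
value of an arrangement with one coordinate for each monomial of `q`, which gives
`k ≤ (n + 1) ^ d ≤ n ^ (2 * d)` for `n ≥ 2`, and thus the lower bound on `udeg` with the constant
`1/2` (`arrDim_distAnd_le`, `half_mul_logb_arrDim_le_udeg`).

For ODD-MAX-BIT both sides of the relation are of constant order. The alternating sum
`∑ i, (-2) ^ i * x i` is dominated by its last nonzero term, so its sign computes the function and
the unbounded error degree is at most one (`udeg_oddMaxBit_le_one`). On the other hand, the unit
vectors at the odd (one-based) positions are shattered: on such a vector, `OMB (x ∧ y)` reads off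
the bit of `y` at that position. Half-spaces in `ℝ^k` shatter at most `k + 1` points, since the
shattered points, extended by a constant coordinate, are linearly independent
(`card_le_arrDim_add_one`). So `k ≥ n / 2 - 1` and `log k / log n` is bounded below.
-/

/-! ### From polynomials to arrangements -/

/-- There are at most `(n + 1) ^ d` monomials of degree at most `d` in `n` variables. -/
theorem exists_finset_degree_le (n d : ℕ) :
    ∃ T : Finset (Fin n →₀ ℕ), T.card ≤ (n + 1) ^ d ∧ ∀ s, s.degree ≤ d → s ∈ T := by
  classical
  induction d with
  | zero =>
    refine ⟨{0}, by simp, fun s hs => ?_⟩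
    simpa [Finsupp.degree_eq_zero_iff] using hs
  | succ d ih =>
    obtain ⟨T, hT, hmem⟩ := ih
    -- A monomial of degree at most `d + 1` has degree at most `d`, or it is a variable times one.
    refine ⟨Finset.image₂ (fun s (o : Option (Fin n)) => s + o.elim 0 fun i => Finsupp.single i 1)
      T Finset.univ, ?_, fun s hs => ?_⟩
    · refine (Finset.card_image₂_le _ _ _).trans ?_
      rw [pow_succ]
      simpa using Nat.mul_le_mul_right (n + 1) hT
    · rw [Finset.mem_image₂]
      by_cases h0 : s = 0
      · exact ⟨0, hmem 0 (by simp), none, Finset.mem_univ _, by simp [h0]⟩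
      · obtain ⟨i, hi⟩ := Finsupp.support_nonempty_iff.mpr h0
        have hle : Finsupp.single i 1 ≤ s := by
          rw [Finsupp.single_le_iff]
          exact Nat.one_le_iff_ne_zero.mpr (Finsupp.mem_support_iff.mp hi)
        have hs' : s - Finsupp.single i 1 + Finsupp.single i 1 = s := tsub_add_cancel_of_le hle
        refine ⟨s - Finsupp.single i 1, hmem _ ?_, some i, Finset.mem_univ _, hs'⟩
        rw [← hs', map_add, Finsupp.degree_single] at hs
        omega

theorem card_support_le_of_totalDegree {n : ℕ} (q : MvPolynomial (Fin n) ℝ) :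
    q.support.card ≤ (n + 1) ^ q.totalDegree := by
  obtain ⟨T, hT, hmem⟩ := exists_finset_degree_le n q.totalDegree
  exact (Finset.card_le_card fun s hs => hmem s (MvPolynomial.le_totalDegree hs)).trans hT

theorem evalBits_and {n : ℕ} (q : MvPolynomial (Fin n) ℝ) (x y : Fin n → Bool) :
    evalBits q (fun i => x i && y i) = ∑ s ∈ q.support,
      (∏ i, (if x i then (1 : ℝ) else 0) ^ s i) *
        (q.coeff s * ∏ i, (if y i then (1 : ℝ) else 0) ^ s i) := by
  rw [evalBits, MvPolynomial.eval_eq']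
  refine Finset.sum_congr rfl fun s _ => ?_
  rw [mul_left_comm, ← Finset.prod_mul_distrib]
  congr 1
  refine Finset.prod_congr rfl fun i _ => ?_
  rw [← mul_pow]
  cases x i <;> cases y i <;> simp

/-- The monomials of an unbounded error polynomial are the coordinates of an arrangement. -/
theorem arrDim_distAnd_le_card_support {n : ℕ} {F : BoolFn n} {q : MvPolynomial (Fin n) ℝ}
    (hq : IsUnboundedErrorPoly F q) : arrDim (distAnd F) ≤ q.support.card := by
  let e := q.support.equivFin
  refine Nat.sInf_le ⟨⟨fun x j => ∏ i, (if x i then (1 : ℝ) else 0) ^ (e.symm j).1 i,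
    fun y j => q.coeff (e.symm j).1 * ∏ i, (if y i then (1 : ℝ) else 0) ^ (e.symm j).1 i,
    fun _ => 1 / 2⟩, fun x y => ?_⟩
  have key : ∑ j, (∏ i, (if x i then (1 : ℝ) else 0) ^ (e.symm j).1 i) *
      (q.coeff (e.symm j).1 * ∏ i, (if y i then (1 : ℝ) else 0) ^ (e.symm j).1 i) =
      evalBits q (fun i => x i && y i) := by
    rw [evalBits_and, ← Finset.sum_coe_sort q.support]
    exact e.symm.sum_comp fun s : q.support => (∏ i, (if x i then (1 : ℝ) else 0) ^ s.1 i) *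
      (q.coeff s.1 * ∏ i, (if y i then (1 : ℝ) else 0) ^ s.1 i)
  simp only [dotProduct, key, sub_pos, sub_neg]
  exact ⟨hq.gt_half _, hq.lt_half _⟩

/-- Multilinear interpolation of `F`, extended by `0` outside its domain. -/
theorem exists_isUnboundedErrorPoly {n : ℕ} (F : BoolFn n) : ∃ q, IsUnboundedErrorPoly F q := by
  classical
  let v : (Fin n → Bool) → ℝ := fun a => if F a = some true then 1 else 0
  let L : (Fin n → Bool) → Fin n → MvPolynomial (Fin n) ℝ := fun a j =>
    if a j then MvPolynomial.X j else 1 - MvPolynomial.X j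
  let q : MvPolynomial (Fin n) ℝ := ∑ a, MvPolynomial.C (v a) * ∏ j, L a j
  have heval : ∀ x, evalBits q x = v x := by
    intro x
    simp only [q, evalBits, map_sum, map_mul, map_prod, MvPolynomial.eval_C]
    rw [Finset.sum_eq_single x]
    · rw [Finset.prod_eq_one, mul_one]
      intro j _
      cases h : x j <;> simp [L, h]
    · intro a _ hax
      obtain ⟨j, hj⟩ := Function.ne_iff.mp hax
      rw [Finset.prod_eq_zero (Finset.mem_univ j), mul_zero]
      cases h : x j <;> cases h' : a j <;> simp_all [L]
    · simp
  refine ⟨q, fun i => ?_, fun x => ?_, fun x hx => ?_, fun x hx => ?_⟩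
  · refine (MvPolynomial.degreeOf_sum_le _ _ _).trans (Finset.sup_le fun a _ => ?_)
    refine (MvPolynomial.degreeOf_C_mul_le _ _ _).trans
      ((MvPolynomial.degreeOf_prod_le _ _ _).trans ?_)
    have h1 : ∀ j, (L a j).degreeOf i ≤ if i = j then 1 else 0 := by
      intro j
      simp only [L]
      split_ifs with ha hij hij
      · simp [hij]
      · simp [MvPolynomial.degreeOf_X, hij]
      · refine (MvPolynomial.degreeOf_sub_le _ _ _).trans ?_
        simp [hij, MvPolynomial.degreeOf_one]
      · refine (MvPolynomial.degreeOf_sub_le _ _ _).trans ?_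
        simp [MvPolynomial.degreeOf_X, hij, MvPolynomial.degreeOf_one]
    exact (Finset.sum_le_sum fun j _ => h1 j).trans (by simp)
  · rw [heval]
    simp only [v]
    split_ifs <;> simp
  · rw [heval]
    simp only [v, hx, if_true]
    norm_num
  · rw [heval]
    simp [v, hx]

theorem arrDim_distAnd_le {n : ℕ} (F : BoolFn n) : arrDim (distAnd F) ≤ (n + 1) ^ udeg F := by
  obtain ⟨q₀, hq₀⟩ := exists_isUnboundedErrorPoly F
  obtain ⟨q, hq, hd⟩ : udeg F ∈ {d | ∃ q : MvPolynomial (Fin n) ℝ,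
      IsUnboundedErrorPoly F q ∧ q.totalDegree = d} := Nat.sInf_mem ⟨_, q₀, hq₀, rfl⟩
  rw [← hd]
  exact (arrDim_distAnd_le_card_support hq).trans (card_support_le_of_totalDegree q)

theorem half_mul_logb_arrDim_le_udeg {n : ℕ} (hn : 2 ≤ n) (F : BoolFn n) :
    1 / 2 * (Real.logb 2 (arrDim (distAnd F) : ℝ) / Real.logb 2 (n : ℝ)) ≤ (udeg F : ℝ) := by
  have hlog : 0 < Real.logb 2 (n : ℝ) :=
    Real.logb_pos one_lt_two (by exact_mod_cast (by omega : 1 < n))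
  have hk : Real.logb 2 (arrDim (distAnd F) : ℝ) ≤ 2 * udeg F * Real.logb 2 (n : ℝ) := by
    rcases Nat.eq_zero_or_pos (arrDim (distAnd F)) with h | h
    · rw [h, Nat.cast_zero, Real.logb_zero]
      positivity
    · have h1 : arrDim (distAnd F) ≤ n ^ (2 * udeg F) := by
        refine (arrDim_distAnd_le F).trans ?_
        rw [pow_mul]
        exact Nat.pow_le_pow_left (by nlinarith) _
      have h2 : Real.logb 2 (arrDim (distAnd F) : ℝ) ≤ Real.logb 2 ((n : ℝ) ^ (2 * udeg F)) :=
        Real.logb_le_logb_of_le one_lt_two (by exact_mod_cast h) (by exact_mod_cast h1)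
      rw [Real.logb_pow] at h2
      exact_mod_cast h2
  have := (div_le_iff₀ hlog).mpr hk
  linarith

/-! ### The unbounded error degree of ODD-MAX-BIT -/

theorem maxBit_succ {n : ℕ} (x : Fin (n + 1) → Bool) :
    maxBit x = if x (Fin.last n) then n + 1 else maxBit fun i => x i.castSucc := by
  have hle : maxBit (fun i => x i.castSucc) ≤ n :=
    Finset.sup_le fun i _ => i.isLt
  have h : maxBit x = max (if x (Fin.last n) then n + 1 else 0) (maxBit fun i => x i.castSucc) := by
    unfold maxBit
    rw [Fin.univ_castSuccEmb, Finset.filter_cons]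
    split_ifs
    · simp [Finset.filter_map, Finset.sup_map, Function.comp_def]
    · simp only [Finset.filter_map, Finset.sup_map, Function.comp_def, Nat.zero_max]
      rfl
  rw [h]
  split_ifs
  · exact max_eq_left (hle.trans n.le_succ)
  · simp

/-- The alternating sum `∑ i, (-2) ^ i * x i` is dominated by the term of the largest index. -/
theorem sum_neg_two_pow {n : ℕ} (x : Fin n → Bool) :
    (maxBit x % 2 = 1 → 1 ≤ ∑ i : Fin n, (-2 : ℝ) ^ (i : ℕ) * if x i then 1 else 0) ∧
    (maxBit x % 2 = 0 → ∑ i : Fin n, (-2 : ℝ) ^ (i : ℕ) * (if x i then 1 else 0) ≤ 0) ∧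
    |∑ i : Fin n, (-2 : ℝ) ^ (i : ℕ) * if x i then 1 else 0| ≤ 2 ^ n - 1 := by
  induction n with
  | zero => simp [maxBit]
  | succ n ih =>
    obtain ⟨h1, h2, h3⟩ := ih fun i => x i.castSucc
    rw [Fin.sum_univ_castSucc, maxBit_succ]
    simp only [Fin.val_castSucc, Fin.val_last]
    rw [abs_le] at h3 ⊢
    have hp : (1 : ℝ) ≤ 2 ^ n := one_le_pow₀ one_le_two
    rw [pow_succ (2 : ℝ)]
    cases hx : x (Fin.last n)
    · simp only [Bool.false_eq_true, if_false, mul_zero, add_zero]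
      exact ⟨h1, h2, by linarith, by linarith⟩
    · simp only [if_true, mul_one]
      rcases Nat.even_or_odd n with he | ho
      · rw [he.neg_pow]
        have := Nat.even_iff.mp he
        refine ⟨fun _ => by linarith, fun h => by omega, by linarith, by linarith⟩
      · rw [ho.neg_pow]
        have := Nat.odd_iff.mp ho
        refine ⟨fun h => by omega, fun _ => by linarith, by linarith, by linarith⟩

theorem udeg_oddMaxBit_le_one (n : ℕ) : udeg (BoolFn.ofTotal (oddMaxBit n)) ≤ 1 := by
  -- The shift by `1/2` makes the value at `x = 0` strictly smaller than `1/2`.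
  let q : MvPolynomial (Fin n) ℝ := MvPolynomial.C (1 / 2 - 1 / 2 / 2 ^ (n + 1)) +
    ∑ i : Fin n, MvPolynomial.C ((-2) ^ (i : ℕ) / 2 ^ (n + 1)) * MvPolynomial.X i
  have heval : ∀ x, evalBits q x = 1 / 2 +
      ((∑ i : Fin n, (-2 : ℝ) ^ (i : ℕ) * if x i then 1 else 0) - 1 / 2) / 2 ^ (n + 1) := by
    intro x
    simp only [q, evalBits, map_add, map_sum, map_mul, MvPolynomial.eval_C, MvPolynomial.eval_X]
    simp only [div_mul_eq_mul_div, ← Finset.sum_div]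
    ring
  have hpos : (0 : ℝ) < 2 ^ (n + 1) := by positivity
  have hdeg : q.totalDegree ≤ 1 := by
    refine (MvPolynomial.totalDegree_add _ _).trans
      (max_le ((MvPolynomial.totalDegree_C _).trans_le zero_le_one) ?_)
    refine MvPolynomial.totalDegree_finsetSum_le fun i _ => ?_
    refine (MvPolynomial.totalDegree_mul _ _).trans ?_
    simp
  have hq : IsUnboundedErrorPoly (BoolFn.ofTotal (oddMaxBit n)) q := by
    refine ⟨fun i => (MvPolynomial.degreeOf_le_totalDegree _ _).trans hdeg, fun x => ?_,
      fun x hx => ?_, fun x hx => ?_⟩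
    · have h := abs_le.mp (sum_neg_two_pow x).2.2
      set S := ∑ i : Fin n, (-2 : ℝ) ^ (i : ℕ) * if x i then 1 else 0
      have h1 : (S - 1 / 2) / 2 ^ (n + 1) ≤ 1 / 2 := by
        rw [div_le_iff₀ hpos, pow_succ]
        linarith
      have h2 : -1 / 2 ≤ (S - 1 / 2) / 2 ^ (n + 1) := by
        rw [le_div_iff₀ hpos, pow_succ]
        linarith
      rw [heval]
      constructor <;> linarith
    · have h : maxBit x % 2 = 1 := by simpa [BoolFn.ofTotal, oddMaxBit] using hx
      have h1 := (sum_neg_two_pow x).1 h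
      rw [heval]
      exact lt_add_of_pos_right _ (div_pos (by linarith) hpos)
    · have h : maxBit x % 2 = 0 := by simpa [BoolFn.ofTotal, oddMaxBit] using hx
      have h1 := (sum_neg_two_pow x).2.1 h
      rw [heval]
      exact add_lt_of_neg_right _ (div_neg_of_neg_of_pos (by linarith) hpos)
  have hle : udeg (BoolFn.ofTotal (oddMaxBit n)) ≤ q.totalDegree := Nat.sInf_le ⟨q, hq, rfl⟩
  exact hle.trans hdeg

/-! ### Shattered points -/

/-- Half-spaces in `ℝ^k` shatter at most `k + 1` points. -/
theorem Arrangement.Realizes.card_le_of_shatters {A B ι : Type*} [Fintype ι] {k : ℕ}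
    {f : A → B → Option Bool} {P : Arrangement A B k} (hP : P.Realizes f) (a : ι → A)
    (hf : ∀ g : ι → Bool, ∃ y, ∀ i, f (a i) y = some (g i)) : Fintype.card ι ≤ k + 1 := by
  classical
  have hli : LinearIndependent ℝ fun i => (P.point (a i), (1 : ℝ)) := by
    rw [Fintype.linearIndependent_iff]
    intro g hg i
    -- Choose the hyperplane with the sign pattern of the coefficients of the linear relation.
    obtain ⟨y, hy⟩ := hf fun i => decide (0 < g i)
    let u : ι → ℝ := fun i => dotProduct (P.point (a i)) (P.normal y) - P.offset y
    have hsum : ∑ i, g i * u i = 0 := by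
      have h1 : ∑ i, g i • P.point (a i) = 0 := by
        simpa [Prod.fst_sum] using congrArg Prod.fst hg
      have h2 : ∑ i, g i = 0 := by
        simpa [Prod.snd_sum] using congrArg Prod.snd hg
      have h3 : ∑ i, g i * dotProduct (P.point (a i)) (P.normal y) = 0 := by
        have := congrArg (fun z => dotProduct z (P.normal y)) h1
        simpa [sum_dotProduct] using this
      simp only [u, mul_sub, Finset.sum_sub_distrib, h3, ← Finset.sum_mul, h2, zero_mul, sub_zero]
    have hu : ∀ i, 0 ≤ g i * u i ∧ u i ≠ 0 := by
      intro i
      by_cases h : 0 < g i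
      · have := (hP (a i) y).1 (by simp [hy, h])
        exact ⟨mul_nonneg h.le this.le, this.ne'⟩
      · have := (hP (a i) y).2 (by simp [hy, h])
        exact ⟨mul_nonneg_of_nonpos_of_nonpos (not_lt.mp h) this.le, this.ne⟩
    have := (Finset.sum_eq_zero_iff_of_nonneg fun i _ => (hu i).1).mp hsum i (Finset.mem_univ i)
    exact (mul_eq_zero.mp this).resolve_right (hu i).2
  simpa using hli.fintype_card_le_finrank

/-- Taking the standard basis of `ℝ^A` as points shows that some dimension is always sufficient, so
that `arrDim f` is attained. -/
theorem exists_arrangement_realizes_arrDim {A B : Type*} [Fintype A] (f : A → B → Option Bool) :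
    ∃ P : Arrangement A B (arrDim f), P.Realizes f := by
  classical
  let e := Fintype.equivFin A
  refine Nat.sInf_mem (s := {k | ∃ P : Arrangement A B k, P.Realizes f})
    ⟨Fintype.card A, ⟨fun x => Pi.single (e x) 1,
      fun y j => if f (e.symm j) y = some true then 1 else -1, fun _ => 0⟩, fun x y => ?_⟩
  constructor <;> intro h <;> simp [h]

theorem card_le_arrDim_add_one {A B ι : Type*} [Fintype A] [Fintype ι]
    {f : A → B → Option Bool} (a : ι → A)
    (hf : ∀ g : ι → Bool, ∃ y, ∀ i, f (a i) y = some (g i)) :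
    Fintype.card ι ≤ arrDim f + 1 := by
  obtain ⟨P, hP⟩ := exists_arrangement_realizes_arrDim f
  exact hP.card_le_of_shatters a hf

theorem maxBit_single_and {n : ℕ} (i : Fin n) (y : Fin n → Bool) :
    maxBit (fun j => decide (j = i) && y j) = if y i then (i : ℕ) + 1 else 0 := by
  unfold maxBit
  cases h : y i
  · rw [Finset.filter_eq_empty_iff.mpr (by simpa using h)]
    simp
  · rw [show (Finset.univ.filter fun j => (decide (j = i) && y j) = true) = {i} by
      ext j
      simp only [Finset.mem_filter, Finset.mem_univ, true_and, Bool.and_eq_true, decide_eq_true_eq,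
        Finset.mem_singleton]
      exact ⟨fun hj => hj.1, fun hj => ⟨hj, hj ▸ h⟩⟩]
    simp

/-- The unit vectors at the indices `0, 2, 4, …` of `Fin n`, that is, at the odd one-based
positions, are shattered. -/
theorem half_le_arrDim_oddMaxBit (n : ℕ) :
    n / 2 ≤ arrDim (distAnd (BoolFn.ofTotal (oddMaxBit n))) + 1 := by
  have h := card_le_arrDim_add_one (f := distAnd (BoolFn.ofTotal (oddMaxBit n)))
    (fun (i : Fin (n / 2)) (j : Fin n) => decide (j = ⟨2 * i, by omega⟩)) fun g =>
      ⟨fun j => if hj : (j : ℕ) / 2 < n / 2 then g ⟨j / 2, hj⟩ else false, fun i => by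
        simp only [distAnd, BoolFn.ofTotal, oddMaxBit, maxBit_single_and]
        cases hg : g i <;> simp [hg]⟩
  simpa using h

theorem one_le_two_mul_logb_arrDim_oddMaxBit {n : ℕ} (hn : 16 ≤ n) :
    1 ≤ 2 * (Real.logb 2 (arrDim (distAnd (BoolFn.ofTotal (oddMaxBit n))) : ℝ) /
      Real.logb 2 (n : ℝ)) := by
  have hk := half_le_arrDim_oddMaxBit n
  set k := arrDim (distAnd (BoolFn.ofTotal (oddMaxBit n)))
  have hlog : 0 < Real.logb 2 (n : ℝ) :=
    Real.logb_pos one_lt_two (by exact_mod_cast (by omega : 1 < n))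
  have hnk : n ≤ k ^ 2 := by
    have h1 : n ≤ 2 * k + 3 := by omega
    have h2 : 7 ≤ k := by omega
    nlinarith
  have h := Real.logb_le_logb_of_le one_lt_two
    (by exact_mod_cast (by omega : 0 < n) : (0 : ℝ) < n) (by exact_mod_cast hnk : (n : ℝ) ≤ k ^ 2)
  rw [Real.logb_pow] at h
  rw [← mul_div_assoc, le_div_iff₀ hlog, one_mul]
  exact_mod_cast h

theorem mainTheorem8 :
    (∃ c : ℝ, 0 < c ∧ ∀ n : ℕ, 2 ≤ n → ∀ F : BoolFn n,
      c * (Real.logb 2 (arrDim (distAnd F) : ℝ) / Real.logb 2 (n : ℝ)) ≤ (udeg F : ℝ)) ∧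
    Asymptotics.IsTheta Filter.atTop
      (fun n : ℕ => (udeg (BoolFn.ofTotal (oddMaxBit n)) : ℝ))
      (fun n : ℕ => Real.logb 2 (arrDim (distAnd (BoolFn.ofTotal (oddMaxBit n))) : ℝ) /
        Real.logb 2 (n : ℝ)) := by
  refine ⟨⟨1 / 2, by norm_num, fun n hn F => half_mul_logb_arrDim_le_udeg hn F⟩, ?_, ?_⟩
  · refine Asymptotics.IsBigO.of_bound 2 ?_
    filter_upwards [Filter.eventually_ge_atTop 16] with n hn
    have h1 := one_le_two_mul_logb_arrDim_oddMaxBit hn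
    have h2 : (udeg (BoolFn.ofTotal (oddMaxBit n)) : ℝ) ≤ 1 := by
      exact_mod_cast udeg_oddMaxBit_le_one n
    rw [Real.norm_of_nonneg (Nat.cast_nonneg _), Real.norm_of_nonneg (by linarith)]
    exact h2.trans h1
  · refine Asymptotics.IsBigO.of_bound 2 ?_
    filter_upwards [Filter.eventually_ge_atTop 16] with n hn
    have h1 := one_le_two_mul_logb_arrDim_oddMaxBit hn
    have h2 := half_mul_logb_arrDim_le_udeg (by omega : 2 ≤ n) (BoolFn.ofTotal (oddMaxBit n))
    rw [Real.norm_of_nonneg (Nat.cast_nonneg _), Real.norm_of_nonneg (by linarith)]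
    linarith
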